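/- **Proposition (Characterization of the algebraic variety).** Let $p$ be a prime. For $M\in \mathrm{SL}_2(\mathbb{F}_p)$ write $\bar M$ for its image in $\mathrm{PSL}_2(\mathbb{F}_p)\le \mathrm{PGL}_2(\mathbb{F}_p)$. Call an element of $\mathrm{PSL}_2(\mathbb{F}_p)$ *split* if a representing matrix is diagonalizable over $\mathbb{F}_p$, *non-split* if a representing matrix is diagonalizable over $\mathbb{F}_{p^2}$ with eigenvalues not in $\mathbb{F}_p$, and *unipotent* if a representing matrix is conjugate to a non-trivial Jordan block with eigenvalue $\pm 1$. For $\gamma,\delta\in \mathrm{SL}_2(\mathbb{F}_p)$ let $$\tilde X^{(2)}_{\gamma,\delta}=\{(\bar A,\bar B,\bar C,\bar D) : A,B,C,D\in \mathrm{SL}_2(\mathbb{F}_p),\ AB^{-1}CD^{-1}=\gamma,\ A^{-1}BC^{-1}D=\delta\}\subseteq \mathrm{PSL}_2(\mathbb{F}_p)^4,$$ and let $X^{(2)}_{\gamma,\delta}=\tilde X^{(2)}_{\gamma,\delta}/\sim$, where $Q\sim R$ if $Q=\hat\gamma R\hat\delta$ (coordinatewise, in $\mathrm{PGL}_2(\mathbb{F}_p)$)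 for some $\hat\gamma\in C_{\mathrm{PGL}_2(\mathbb{F}_p)}(\bar\gamma)$ and $\hat\delta\in C_{\mathrm{PGL}_2(\mathbb{F}_p)}(\bar\delta)$. The character of a homomorphism $\sigma:F_n\to \mathrm{SL}_2(\mathbb{F}_p)$ is the function $w\mapsto \mathrm{tr}(\sigma(w))$ on the free group $F_n$. The $\mathrm{PSL}_2$-character of a homomorphism $\rho: F_n\to \mathrm{PSL}_2(\mathbb{F}_p)$ is the set of the characters of all lifts of $\rho$ to $\mathrm{SL}_2(\mathbb{F}_p)$; $\mathrm{Ch}_{\mathrm{PSL}_2(\mathbb{F}_p)}(F_n)$ is the set of all $\mathrm{PSL}_2$-characters. An $n$-tuple in $\mathrm{PSL}_2(\mathbb{F}_p)$ has a $\mathrm{PSL}_2$-character, namely that of the homomorphism sending the free generators to it. Suppose that $\bar\gamma,\bar\delta$ are non-trivial, not involutions and not unipotent, that one of them is split and the other is non-split, and that $\gamma$ or $\delta$ has order greater than $60$ in $\mathrm{SL}_2(\mathbb{F}_p)$ (which holds in particular if $\bar\gamma$ or $\bar\delta$ has order greater than $60$). Let $$\varphi:\tilde X^{(2)}_{\gamma,\delta}\to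 \mathrm{Ch}_{\mathrm{PSL}_2(\mathbb{F}_p)}(F_3)$$ send $(A,B,C,D)$ to the $\mathrm{PSL}_2$-character of $(B^{-1}A,\,A^{-1}C,\,D^{-1}C)$. Then: 1. $\varphi$ is well defined as a map on $X^{(2)}_{\gamma,\delta}$, and as such it is injective. 2. The image of $\varphi$ consists precisely of the $\mathrm{PSL}_2$-characters of those triples $m\in\mathrm{PSL}_2(\mathbb{F}_p)^3$ that have a lift $(M_1,M_2,M_3)\in \mathrm{SL}_2(\mathbb{F}_p)^3$ with $\mathrm{tr}(M_1M_3)=\mathrm{tr}(\delta)$ and $\mathrm{tr}(M_1M_2M_3M_2^{-1})=\mathrm{tr}(\gamma)$. Moreover, whether such a lift exists depends only on the $\mathrm{PSL}_2$-character of $m$. -/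

import Mathlib

open scoped MatrixGroups

noncomputable section

namespace BraidPSL

/-- The projection `M ↦ M̄` from `SL₂(𝔽_p)` to `PSL₂(𝔽_p)`. -/
def bar (p : ℕ) : SL(2, ZMod p) →* PSL(2, ZMod p) :=
  QuotientGroup.mk' (Subgroup.center SL(2, ZMod p))

/-- An element of `PSL₂(𝔽_p)` is split if it is represented by a matrix that is diagonalizable
over `𝔽_p`. -/
def IsSplit {p : ℕ} (x : PSL(2, ZMod p)) : Prop :=
  ∃ M : SL(2, ZMod p), bar p M = x ∧
    ∃ (g : GL (Fin 2) (ZMod p)) (d : Fin 2 → ZMod p),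
      g.val * M.val * (g⁻¹).val = Matrix.diagonal d

/-- An element of `PSL₂(𝔽_p)` is non-split if it is represented by a matrix that is diagonalizable
over `𝔽_{p²}`, with eigenvalues outside `𝔽_p`. -/
def IsNonsplit {p : ℕ} [Fact p.Prime] (x : PSL(2, ZMod p)) : Prop :=
  ∃ M : SL(2, ZMod p), bar p M = x ∧
    ∃ (g : GL (Fin 2) (GaloisField p 2)) (d : Fin 2 → GaloisField p 2),
      g.val * M.val.map (algebraMap (ZMod p) (GaloisField p 2)) * (g⁻¹).val = Matrix.diagonal d ∧
      ∀ i, d i ∉ Set.range (algebraMap (ZMod p) (GaloisField p 2))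

/-- An element of `PSL₂(𝔽_p)` is unipotent if it is represented by a matrix that is conjugate to a
non-trivial Jordan block with eigenvalue `1` or `-1`. -/
def IsUnipotent {p : ℕ} (x : PSL(2, ZMod p)) : Prop :=
  ∃ M : SL(2, ZMod p), bar p M = x ∧
    ∃ (g : GL (Fin 2) (ZMod p)) (e : ZMod p), (e = 1 ∨ e = -1) ∧
      g.val * M.val * (g⁻¹).val = !![e, 1; 0, e]

/-- `x` and `y` are non-trivial, are not involutions and are not unipotent, and one of them is split
while the other is non-split. -/
def SplitNonsplit {p : ℕ} [Fact p.Prime] (x y : PSL(2, ZMod p)) : Prop :=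
  (x ≠ 1 ∧ orderOf x ≠ 2 ∧ ¬ IsUnipotent x) ∧
  (y ≠ 1 ∧ orderOf y ≠ 2 ∧ ¬ IsUnipotent y) ∧
  ((IsSplit x ∧ IsNonsplit y) ∨ (IsNonsplit x ∧ IsSplit y))

/-- The set `X̃⁽²⁾_{γ,δ}`: the quadruples `(Ā, B̄, C̄, D̄)` in `PSL₂(𝔽_p)` that come from quadruples
in `SL₂(𝔽_p)` with `A B⁻¹ C D⁻¹ = γ` and `A⁻¹ B C⁻¹ D = δ`. -/
def Xtilde {p : ℕ} (γ δ : SL(2, ZMod p)) : Set (Fin 4 → PSL(2, ZMod p)) :=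
  {Q | ∃ A B C D : SL(2, ZMod p),
    A * B⁻¹ * C * D⁻¹ = γ ∧ A⁻¹ * B * C⁻¹ * D = δ ∧
    Q = ![bar p A, bar p B, bar p C, bar p D]}

/-- The inclusion of `PSL₂(𝔽_p)` in `PGL₂(𝔽_p)`. -/
abbrev inPGL (p : ℕ) : PSL(2, ZMod p) →* PGL(Fin 2, ZMod p) :=
  Matrix.ProjectiveSpecialLinearGroup.toPGL

/-- `Q ∼ R` if `Q = γ' R δ'` for some `γ'` in the centralizer of `γ̄` and some `δ'` in the centralizer
of `δ̄`, both taken in `PGL₂(𝔽_p)`. -/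
def Equivalent {p : ℕ} (γ δ : SL(2, ZMod p)) (Q R : Fin 4 → PSL(2, ZMod p)) : Prop :=
  ∃ γ' ∈ Subgroup.centralizer {inPGL p (bar p γ)},
    ∃ δ' ∈ Subgroup.centralizer {inPGL p (bar p δ)},
      ∀ i, inPGL p (Q i) = γ' * inPGL p (R i) * δ'

/-- The equivalence relation `∼` on `X̃⁽²⁾_{γ,δ}`. -/
def xSetoid {p : ℕ} (γ δ : SL(2, ZMod p)) : Setoid (Xtilde γ δ) where
  r Q R := Equivalent γ δ Q.1 R.1
  iseqv :=
    { refl := fun _ => ⟨1, one_mem _, 1, one_mem _, fun _ => by simp⟩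
      symm := by
        rintro Q R ⟨g, hg, d, hd, h⟩
        exact ⟨g⁻¹, inv_mem hg, d⁻¹, inv_mem hd, fun i => by rw [h i]; group⟩
      trans := by
        rintro Q R S ⟨g, hg, d, hd, h⟩ ⟨g', hg', d', hd', h'⟩
        exact ⟨g * g', mul_mem hg hg', d' * d, mul_mem hd' hd, fun i => by
          rw [h i, h' i]; group⟩ }

/-- The quotient `X⁽²⁾_{γ,δ} = X̃⁽²⁾_{γ,δ} / ∼`. -/
abbrev X {p : ℕ} (γ δ : SL(2, ZMod p)) : Type := Quotient (xSetoid γ δ)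

/-- The character `w ↦ tr ρ(w)` of a homomorphism `ρ : F_n → SL₂(𝔽_p)`. -/
def slCharacter {p n : ℕ} (ρ : FreeGroup (Fin n) →* SL(2, ZMod p)) :
    FreeGroup (Fin n) → ZMod p :=
  fun w => Matrix.trace (ρ w).val

/-- The `PSL₂`-character of a homomorphism `ρ : F_n → PSL₂(𝔽_p)`: the set of the characters of all
the lifts of `ρ` to homomorphisms `F_n → SL₂(𝔽_p)`. -/
def pslCharacter {p n : ℕ} (ρ : FreeGroup (Fin n) →* PSL(2, ZMod p)) :
    Set (FreeGroup (Fin n) → ZMod p) :=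
  {τ | ∃ σ : FreeGroup (Fin n) →* SL(2, ZMod p), (bar p).comp σ = ρ ∧ τ = slCharacter σ}

/-- The set `Ch_{PSL₂(𝔽_p)}(F_n)` of the `PSL₂`-characters of `F_n`. -/
abbrev CharPSL (p n : ℕ) : Type :=
  Set.range (pslCharacter : (FreeGroup (Fin n) →* PSL(2, ZMod p)) → _)

/-- The `PSL₂`-character of the homomorphism `F_n → PSL₂(𝔽_p)` that sends the generators to a given
`n`-tuple. -/
def tupleCharacter {p n : ℕ} (m : Fin n → PSL(2, ZMod p)) : CharPSL p n :=
  ⟨pslCharacter (FreeGroup.lift m), FreeGroup.lift m, rfl⟩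

/-- The map `φ(A, B, C, D) = (B⁻¹ A, A⁻¹ C, D⁻¹ C)` from `X̃⁽²⁾_{γ,δ}` to `Ch_{PSL₂(𝔽_p)}(F_3)`. -/
def phi {p : ℕ} (γ δ : SL(2, ZMod p)) (Q : Xtilde γ δ) : CharPSL p 3 :=
  tupleCharacter ![(Q.1 1)⁻¹ * Q.1 0, (Q.1 0)⁻¹ * Q.1 2, (Q.1 3)⁻¹ * Q.1 2]

end BraidPSL

end

open scoped MatrixGroups

namespace BraidPSL

open Matrix

/-! ### Conjugacy and spanning in two-by-two matrices over a field. -/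

section Field

variable {K : Type*} [Field K]

/-! Left factors cancel in the quotients and right factors conjugate them, so `φ` descends to the
quotient set. If two quadruples have the same image, lifts of their triples share a character. Two
words in the lift have traces `tr δ` and `tr γ`: one image has no eigenvalue in the field, the other
has two. They generate the matrix algebra (`span_eq_top`), so equal traces give an inner
automorphism (`exists_slConj_eq_of_trace_eq`), and conjugate triples of quotients come from
equivalent quadruples (`exists_conj_of_quotients_conj`).

For the image, the trace conditions are read off a single lift. Conversely, conjugating in `GL₂`
gives `δ`; a further conjugation, necessarily in `SL₂` (`exists_mul_mul_inv_eq`), gives `γ` and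
supplies `A`. -/

/-- Conjugation of `SL₂` by an element of `GL₂`. -/
def slConj (g : GL (Fin 2) K) : SL(2, K) →* SL(2, K) where
  toFun M := ⟨g.val * M.val * (g⁻¹).val, by
    rw [det_mul, det_mul, M.2, mul_one, ← det_mul, ← Units.val_mul, mul_inv_cancel, Units.val_one,
      det_one]⟩
  map_one' := by
    apply Subtype.ext
    change g.val * 1 * (g⁻¹).val = 1
    rw [mul_one, ← Units.val_mul, mul_inv_cancel, Units.val_one]
  map_mul' M N := by
    apply Subtype.ext
    change g.val * (M.val * N.val) * (g⁻¹).val =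
      (g.val * M.val * (g⁻¹).val) * (g.val * N.val * (g⁻¹).val)
    have h : (g⁻¹).val * g.val = 1 := by rw [← Units.val_mul, inv_mul_cancel, Units.val_one]
    calc _ = g.val * M.val * 1 * N.val * (g⁻¹).val := by noncomm_ring
      _ = _ := by rw [← h]; noncomm_ring

lemma slConj_val (g : GL (Fin 2) K) (M : SL(2, K)) :
    (slConj g M).val = g.val * M.val * (g⁻¹).val := rfl

lemma trace_slConj (g : GL (Fin 2) K) (M : SL(2, K)) :
    trace (slConj g M).val = trace M.val := by
  rw [slConj_val, trace_mul_comm, ← mul_assoc, ← Units.val_mul, inv_mul_cancel, Units.val_one,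
    one_mul]

lemma toGL_slConj (g : GL (Fin 2) K) (M : SL(2, K)) :
    SpecialLinearGroup.toGL (slConj g M) = g * SpecialLinearGroup.toGL M * g⁻¹ :=
  Units.ext rfl

lemma trace_inv (M : SL(2, K)) : trace (M⁻¹).val = trace M.val := by
  change trace (adjugate M.val) = _
  rw [adjugate_fin_two, trace_fin_two, trace_fin_two]
  exact add_comm _ _

/-- The norm form of the algebra generated by `M`: its zeros detect eigenvalues, its values are
determinants of matrices commuting with `M`. -/
lemma det_add_smul (M : SL(2, K)) (x y : K) :
    det (x • (1 : Matrix (Fin 2) (Fin 2) K) + y • M.val) = x ^ 2 + x * y * trace M.val + y ^ 2 := by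
  have h := M.2
  rw [det_fin_two] at h
  rw [det_fin_two, trace_fin_two]
  simp
  linear_combination y ^ 2 * h

lemma ne_smul_one_of_trace {M : SL(2, K)} (h : trace M.val ^ 2 ≠ 4) (r : K) :
    M.val ≠ r • (1 : Matrix (Fin 2) (Fin 2) K) := by
  intro e
  have hd := M.2
  rw [e, det_smul, det_one, Fintype.card_fin] at hd
  rw [e, trace_smul, trace_one, Fintype.card_fin, smul_eq_mul] at h
  exact h (by push_cast; linear_combination 4 * hd)

/-- A non-scalar matrix has a cyclic vector. -/
lemma exists_companion {M : SL(2, K)} (h : trace M.val ^ 2 ≠ 4) :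
    ∃ g : GL (Fin 2) K, M.val * g.val = g.val * !![0, -1; 1, trace M.val] := by
  obtain ⟨x, y, hxy⟩ : ∃ x y : K,
      det !![x, M.val 0 0 * x + M.val 0 1 * y; y, M.val 1 0 * x + M.val 1 1 * y] ≠ 0 := by
    -- Otherwise both basis vectors and their sum are eigenvectors, which forces a scalar matrix.
    by_contra! hc
    have h₁ := hc 1 0
    have h₂ := hc 0 1
    have h₃ := hc 1 1
    simp [det_fin_two] at h₁ h₂ h₃
    refine ne_smul_one_of_trace h (M.val 0 0) ?_
    ext i j
    fin_cases i <;> fin_cases j <;> simp [h₁, h₂]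
    linear_combination h₃ - h₁ + h₂
  refine ⟨GeneralLinearGroup.mkOfDetNeZero _ hxy, ?_⟩
  have hd := M.2
  rw [det_fin_two] at hd
  change M.val * !![_, _; _, _] = !![_, _; _, _] * _
  rw [trace_fin_two]
  ext i j
  fin_cases i <;> fin_cases j <;> simp [mul_apply, Fin.sum_univ_two]
  · linear_combination (-x) * hd
  · linear_combination (-y) * hd

lemma exists_slConj_eq {M N : SL(2, K)} (h : trace M.val ^ 2 ≠ 4)
    (hMN : trace M.val = trace N.val) : ∃ g : GL (Fin 2) K, slConj g M = N := by
  obtain ⟨a, ha⟩ := exists_companion h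
  obtain ⟨b, hb⟩ := exists_companion (M := N) (hMN ▸ h)
  rw [← hMN] at hb
  refine ⟨b * a⁻¹, Subtype.ext ?_⟩
  have haa : (a⁻¹).val * a.val = 1 := by rw [← Units.val_mul, inv_mul_cancel, Units.val_one]
  have hbb : b.val * (b⁻¹).val = 1 := by rw [← Units.val_mul, mul_inv_cancel, Units.val_one]
  rw [slConj_val, _root_.mul_inv_rev, inv_inv, Units.val_mul, Units.val_mul]
  calc b.val * (a⁻¹).val * M.val * (a.val * (b⁻¹).val)
      = b.val * (a⁻¹).val * (M.val * a.val) * (b⁻¹).val := by simp only [mul_assoc]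
    _ = b.val * ((a⁻¹).val * a.val) * !![0, -1; 1, trace M.val] * (b⁻¹).val := by
      rw [ha]; simp only [mul_assoc]
    _ = N.val * (b.val * (b⁻¹).val) := by rw [haa, mul_one, ← hb, mul_assoc]
    _ = N.val := by rw [hbb, mul_one]

/-- An element without eigenvalues in the field and an element with two distinct eigenvalues span
the matrix algebra together with their product and the identity. -/
lemma span_eq_top {U V : SL(2, K)} (hU : ∀ l : K, l ^ 2 - trace U.val * l + 1 ≠ 0)
    (hV : ∃ l : K, l ^ 2 - trace V.val * l + 1 = 0) (hV' : trace V.val ^ 2 ≠ 4) :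
    Submodule.span K (Set.range ![1, U.val, V.val, U.val * V.val]) = ⊤ := by
  -- The algebra generated by `U` is a field: its nonzero elements are invertible.
  have key : ∀ x y : K, det (x • (1 : Matrix (Fin 2) (Fin 2) K) + y • U.val) = 0 →
      x = 0 ∧ y = 0 := by
    intro x y hxy
    rw [det_add_smul] at hxy
    by_cases hy : y = 0
    · subst hy
      exact ⟨by simpa using hxy, rfl⟩
    · refine absurd ?_ (hU (-x / y))
      field_simp
      linear_combination hxy
  obtain ⟨l, hl⟩ := hV
  have hVl : det (V.val - l • (1 : Matrix (Fin 2) (Fin 2) K)) = 0 := by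
    have := det_add_smul V (-l) 1
    rw [one_smul, neg_smul, neg_add_eq_sub] at this
    rw [this]
    linear_combination hl
  refine LinearIndependent.span_eq_top_of_card_eq_finrank' ?_ (by simp [Module.finrank_matrix])
  rw [Fintype.linearIndependent_iff]
  intro c hc
  rw [Fin.sum_univ_four] at hc
  simp only [Matrix.cons_val] at hc
  set N := c 2 • (1 : Matrix (Fin 2) (Fin 2) K) + c 3 • U.val with hN
  -- Modulo `V - l` the relation lies in the field generated by `U`. Since `V - l` is singular, that
  -- element vanishes; an invertible `N` would then make `V` scalar.
  have h₁ : (c 0 + l * c 2) • (1 : Matrix (Fin 2) (Fin 2) K) + (c 1 + l * c 3) • U.val =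
      -(N * (V.val - l • (1 : Matrix (Fin 2) (Fin 2) K))) := by
    rw [← sub_eq_zero, ← hc, hN]
    simp only [mul_sub, add_mul, smul_mul_assoc, mul_smul_comm, one_mul, mul_one, add_smul,
      mul_smul, smul_add]
    abel
  have h₂ := key _ _ (by rw [h₁, det_neg, det_mul, hVl, mul_zero, mul_zero])
  rw [h₂.1, h₂.2, zero_smul, zero_smul, add_zero, eq_comm, neg_eq_zero] at h₁
  have h₃ : c 2 = 0 ∧ c 3 = 0 := by
    by_contra hne
    have hdet : IsUnit N.det := isUnit_iff_ne_zero.2 fun h => hne (key _ _ h)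
    have h₄ : V.val - l • (1 : Matrix (Fin 2) (Fin 2) K) = 0 := by
      simpa only [nonsing_inv_mul_cancel_left _ _ hdet, Matrix.mul_zero] using
        congrArg (N⁻¹ * ·) h₁
    exact ne_smul_one_of_trace hV' l (sub_eq_zero.1 h₄)
  have h₀ := h₂.1
  have h₁' := h₂.2
  rw [h₃.1, mul_zero, add_zero] at h₀
  rw [h₃.2, mul_zero, add_zero] at h₁'
  intro i
  fin_cases i
  exacts [h₀, h₁', h₃.1, h₃.2]

/-- Every automorphism of the matrix algebra is inner. -/
lemma exists_conj_of_algEquiv {n : Type*} [Fintype n] [DecidableEq n]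
    (f : Matrix n n K ≃ₐ[K] Matrix n n K) :
    ∃ g : GL n K, ∀ M, f M = g.val * M * (g⁻¹).val := by
  obtain ⟨T, hT⟩ := AlgEquiv.eq_linearEquivConjAlgEquiv
    ((toLinAlgEquiv'.symm.trans f).trans (toLinAlgEquiv' (R := K) (n := n)))
  have h₁ : LinearMap.toMatrix' T.toLinearMap * LinearMap.toMatrix' T.symm.toLinearMap = 1 := by
    rw [← LinearMap.toMatrix'_comp]; simp
  have h₂ : LinearMap.toMatrix' T.symm.toLinearMap * LinearMap.toMatrix' T.toLinearMap = 1 := by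
    rw [← LinearMap.toMatrix'_comp]; simp
  refine ⟨⟨_, _, h₁, h₂⟩, fun M => ?_⟩
  have h := congrArg LinearMap.toMatrix' (AlgEquiv.congr_fun hT (toLin' M))
  have h' : ((toLinAlgEquiv'.symm.trans f).trans (toLinAlgEquiv' (R := K) (n := n))) (toLin' M) =
      toLin' (f M) := by
    change toLin' (f (LinearMap.toMatrix' (toLin' M))) = _
    rw [LinearMap.toMatrix'_toLin']
  rw [h', LinearMap.toMatrix'_toLin'] at h
  rw [h, LinearEquiv.conjAlgEquiv_apply, LinearMap.toMatrix'_comp, LinearMap.toMatrix'_comp,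
    LinearMap.toMatrix'_toLin']
  simp [mul_assoc, Units.inv_mk]

/-! ### Representations determined by their characters. -/

variable {G : Type*} [Group G]

/-- The extension to the group algebra of a representation in `SL₂`. -/
noncomputable def algebraRep (σ : G →* SL(2, K)) : MonoidAlgebra K G →ₐ[K] Matrix (Fin 2) (Fin 2) K :=
  MonoidAlgebra.lift K _ G
    { toFun := fun w => (σ w).val
      map_one' := by rw [map_one]; rfl
      map_mul' := fun v w => by rw [map_mul]; rfl }

lemma algebraRep_single (σ : G →* SL(2, K)) (w : G) :
    algebraRep σ (MonoidAlgebra.single w 1) = (σ w).val := by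
  simp [algebraRep]

lemma algebraRep_surjective {σ : G →* SL(2, K)} {u v : G}
    (hu : ∀ l : K, l ^ 2 - trace (σ u).val * l + 1 ≠ 0)
    (hv : ∃ l : K, l ^ 2 - trace (σ v).val * l + 1 = 0) (hv' : trace (σ v).val ^ 2 ≠ 4) :
    Function.Surjective (algebraRep σ) := by
  have h : LinearMap.range (algebraRep σ).toLinearMap = ⊤ := by
    rw [eq_top_iff, ← span_eq_top hu hv hv', Submodule.span_le]
    rintro _ ⟨i, rfl⟩
    fin_cases i
    · exact ⟨1, map_one (algebraRep σ)⟩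
    · exact ⟨_, algebraRep_single σ u⟩
    · exact ⟨_, algebraRep_single σ v⟩
    · refine ⟨_, (algebraRep_single σ (u * v)).trans ?_⟩
      rw [map_mul]
      rfl
  exact LinearMap.range_eq_top.1 h

lemma trace_algebraRep {σ τ : G →* SL(2, K)}
    (h : ∀ w, trace (σ w).val = trace (τ w).val) (a : MonoidAlgebra K G) :
    trace (algebraRep σ a) = trace (algebraRep τ a) := by
  have : (traceLinearMap (Fin 2) K K).comp (algebraRep σ).toLinearMap =
      (traceLinearMap (Fin 2) K K).comp (algebraRep τ).toLinearMap := by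
    refine MonoidAlgebra.lhom_ext' fun w => LinearMap.ext_ring ?_
    change trace (algebraRep σ (MonoidAlgebra.single w 1)) =
      trace (algebraRep τ (MonoidAlgebra.single w 1))
    rw [algebraRep_single, algebraRep_single, h]
  exact LinearMap.congr_fun this a

/-- The trace form is nondegenerate and `τ` is onto, so the kernel of `σ` on the group algebra lies
in that of `τ`. -/
lemma algebraRep_eq_of_eq {σ τ : G →* SL(2, K)}
    (h : ∀ w, trace (σ w).val = trace (τ w).val) (hτ : Function.Surjective (algebraRep τ))
    {a b : MonoidAlgebra K G} (hab : algebraRep σ a = algebraRep σ b) :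
    algebraRep τ a = algebraRep τ b := by
  refine ext_iff_trace_mul_right.2 fun M => ?_
  obtain ⟨c, rfl⟩ := hτ M
  rw [← map_mul, ← map_mul, ← trace_algebraRep h, ← trace_algebraRep h, map_mul, map_mul, hab]

/-- Representations in `SL₂` with the same character are conjugate, if they are absolutely
irreducible because of an element without eigenvalues and an element with two eigenvalues. -/
lemma exists_slConj_eq_of_trace_eq {σ τ : G →* SL(2, K)}
    (h : ∀ w, trace (σ w).val = trace (τ w).val) {u v : G}
    (hu : ∀ l : K, l ^ 2 - trace (σ u).val * l + 1 ≠ 0)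
    (hv : ∃ l : K, l ^ 2 - trace (σ v).val * l + 1 = 0) (hv' : trace (σ v).val ^ 2 ≠ 4) :
    ∃ g : GL (Fin 2) K, ∀ w, τ w = slConj g (σ w) := by
  have hσ : Function.Surjective (algebraRep σ) := algebraRep_surjective hu hv hv'
  have hτ : Function.Surjective (algebraRep τ) :=
    algebraRep_surjective (by simpa only [h] using hu) (by simpa only [h] using hv)
      (by simpa only [h] using hv')
  have hs := Function.rightInverse_surjInv hσ
  set s := Function.surjInv hσ
  have hT : ∀ a, algebraRep τ (s (algebraRep σ a)) = algebraRep τ a := fun a =>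
    algebraRep_eq_of_eq h hτ (hs _)
  let f : Matrix (Fin 2) (Fin 2) K →ₐ[K] Matrix (Fin 2) (Fin 2) K :=
    AlgHom.ofLinearMap
      { toFun := fun M => algebraRep τ (s M)
        map_add' := fun M N => by
          rw [← map_add]
          exact algebraRep_eq_of_eq h hτ (by rw [map_add, hs, hs, hs])
        map_smul' := fun c M => by
          rw [RingHom.id_apply, ← map_smul]
          exact algebraRep_eq_of_eq h hτ (by rw [map_smul, hs, hs]) }
      ((algebraRep_eq_of_eq h hτ (by rw [hs, map_one])).trans (map_one _))
      fun M N => (algebraRep_eq_of_eq h hτ (by rw [map_mul, hs, hs, hs])).trans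
        (map_mul (algebraRep τ) (s M) (s N))
  have hf : Function.Bijective f := by
    constructor
    · intro M N hMN
      have := algebraRep_eq_of_eq (fun w => (h w).symm) hσ (show algebraRep τ (s M) = _ from hMN)
      rwa [hs, hs] at this
    · intro M
      obtain ⟨a, rfl⟩ := hτ M
      exact ⟨_, hT a⟩
  obtain ⟨g, hg⟩ := exists_conj_of_algEquiv (AlgEquiv.ofBijective f hf)
  refine ⟨g, fun w => Subtype.ext ?_⟩
  rw [slConj_val, ← hg, ← algebraRep_single σ, ← algebraRep_single τ]
  exact (hT _).symm

end Field

/-- The lift of the triple of quotients of a quadruple that is determined by a lift of the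
quadruple. -/
lemma lift_quotients {p : ℕ} (A B C D : SL(2, ZMod p)) :
    (bar p).comp (FreeGroup.lift ![B⁻¹ * A, A⁻¹ * C, D⁻¹ * C]) =
      FreeGroup.lift ![(bar p B)⁻¹ * bar p A, (bar p A)⁻¹ * bar p C, (bar p D)⁻¹ * bar p C] := by
  refine FreeGroup.ext_hom _ _ fun i => ?_
  rw [MonoidHom.comp_apply, FreeGroup.lift_apply_of, FreeGroup.lift_apply_of]
  fin_cases i <;> simp

/-! ### Arithmetic and conjugacy over the prime field. -/

section Prime

variable {p : ℕ} [Fact p.Prime]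

/-- For odd `p`, completing the square gives `(2x + ty)² + (4 - t²)y² = 4e`, solvable because a
nondegenerate binary form over a finite field is universal. -/
lemma exists_binary_form_eq {t : ZMod p} (ht : t ^ 2 ≠ 4) {e : ZMod p} (he : e ≠ 0) :
    ∃ x y : ZMod p, x ^ 2 + x * y * t + y ^ 2 = e := by
  rcases (Fact.out : p.Prime).eq_two_or_odd with rfl | hp
  · refine ⟨1, 0, ?_⟩
    revert e
    decide +revert
  · have h2 : (2 : ZMod p) ≠ 0 := by
      intro h
      have h' : ((2 : ℕ) : ZMod p) = 0 := by exact_mod_cast h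
      have := (Nat.prime_dvd_prime_iff_eq Fact.out Nat.prime_two).1
        ((ZMod.natCast_eq_zero_iff 2 p).1 h')
      omega
    obtain ⟨a, b, hab⟩ := FiniteField.exists_root_sum_quadratic
      (Polynomial.degree_quadratic (a := (1 : ZMod p)) (b := 0) (c := -4 * e) one_ne_zero)
      (Polynomial.degree_quadratic (a := 4 - t ^ 2) (b := 0) (c := 0) (sub_ne_zero.2 ht.symm))
      (by rwa [ZMod.card])
    simp at hab
    refine ⟨(a - t * b) / 2, b, ?_⟩
    field_simp
    linear_combination hab

/-- A conjugator in `GL₂` is corrected to determinant one by a factor `x + yM`, which commutes with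
`M` and can have any nonzero determinant. -/
lemma exists_mul_mul_inv_eq {M N : SL(2, ZMod p)} (h : trace M.val ^ 2 ≠ 4)
    (hMN : trace M.val = trace N.val) : ∃ A : SL(2, ZMod p), A * M * A⁻¹ = N := by
  obtain ⟨g, hg⟩ := exists_slConj_eq h hMN
  have hdet : g.val.det ≠ 0 := (g.val.isUnit_iff_isUnit_det.1 g.isUnit).ne_zero
  obtain ⟨x, y, hxy⟩ := exists_binary_form_eq h (inv_ne_zero hdet)
  rw [mul_right_comm, add_right_comm] at hxy
  have hc := det_add_smul M x y
  have hA : det (g.val * (x • 1 + y • M.val)) = 1 := by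
    rw [det_mul, hc]
    linear_combination g.val.det * hxy + mul_inv_cancel₀ hdet
  let A : SL(2, ZMod p) := ⟨_, hA⟩
  have h' : A * M = N * A := by
    rw [← hg]
    apply Subtype.ext
    change g.val * (x • 1 + y • M.val) * M.val =
      g.val * M.val * (g⁻¹).val * (g.val * (x • 1 + y • M.val))
    have hgg : (g⁻¹).val * g.val = 1 := by rw [← Units.val_mul, inv_mul_cancel, Units.val_one]
    rw [mul_assoc (g.val * M.val), ← mul_assoc (g⁻¹).val, hgg, one_mul, mul_assoc, mul_assoc]
    congr 1
    simp only [mul_add, add_mul, smul_mul_assoc, mul_smul_comm, one_mul, mul_one]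
  exact ⟨A, mul_inv_eq_of_eq_mul h'⟩

lemma exists_smul_of_bar_eq {M N : SL(2, ZMod p)} (h : bar p M = bar p N) :
    ∃ r : ZMod p, r ^ 2 = 1 ∧ M.val = r • N.val := by
  obtain ⟨z, hz, hM⟩ := (QuotientGroup.mk'_eq_mk' _).1 h.symm
  obtain ⟨r, hr, hrz⟩ := Matrix.SpecialLinearGroup.mem_center_iff.1 hz
  refine ⟨r, by simpa using hr, ?_⟩
  rw [← hM]
  change N.val * z.val = _
  rw [← hrz, scalar_apply, ← smul_one_eq_diagonal, mul_smul_comm, mul_one]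

lemma bar_eq_one_of_eq_smul_one {M : SL(2, ZMod p)} {r : ZMod p} (h : M.val = r • 1) :
    bar p M = 1 := by
  refine (QuotientGroup.eq_one_iff M).2 (Matrix.SpecialLinearGroup.mem_center_iff.2 ⟨r, ?_, ?_⟩)
  · have := M.2
    rw [h, det_smul, det_one, mul_one] at this
    exact this
  · rw [h, scalar_apply, smul_one_eq_diagonal]

lemma IsSplit.trace_of_ne_one {M : SL(2, ZMod p)} (h : IsSplit (bar p M)) (h1 : bar p M ≠ 1) :
    (∃ l : ZMod p, l ^ 2 - trace M.val * l + 1 = 0) ∧ trace M.val ^ 2 ≠ 4 := by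
  obtain ⟨N, hN, g, d, hd⟩ := h
  obtain ⟨r, hr, hMN⟩ := exists_smul_of_bar_eq hN.symm
  have hdet := (slConj g N).2
  have htr := trace_slConj g N
  rw [slConj_val, hd] at hdet htr
  rw [det_diagonal, Fin.prod_univ_two] at hdet
  rw [trace_diagonal, Fin.sum_univ_two] at htr
  rw [hMN, trace_smul, ← htr, smul_eq_mul]
  refine ⟨⟨r * d 0, ?_⟩, fun h4 => h1 ?_⟩
  · linear_combination (-(d 0 * d 1)) * hr - hdet
  · have h01 : d 0 = d 1 := by
      refine sub_eq_zero.1 (pow_eq_zero_iff two_ne_zero |>.1 ?_)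
      linear_combination h4 - (d 0 + d 1) ^ 2 * hr - 4 * hdet
    rw [← hN]
    have hgg : (g⁻¹).val * g.val = 1 := by rw [← Units.val_mul, inv_mul_cancel, Units.val_one]
    refine bar_eq_one_of_eq_smul_one (r := d 0) ?_
    have hD : diagonal d = d 0 • (1 : Matrix (Fin 2) (Fin 2) (ZMod p)) := by
      ext i j
      fin_cases i <;> fin_cases j <;> simp [h01]
    calc N.val = ((g⁻¹).val * g.val) * N.val * ((g⁻¹).val * g.val) := by
          rw [hgg, one_mul, mul_one]
      _ = (g⁻¹).val * (g.val * N.val * (g⁻¹).val) * g.val := by simp only [mul_assoc]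
      _ = d 0 • 1 := by rw [hd, hD, mul_smul_comm, smul_mul_assoc, mul_one, hgg]

lemma IsNonsplit.charpoly_ne_zero {M : SL(2, ZMod p)} (h : IsNonsplit (bar p M)) (l : ZMod p) :
    l ^ 2 - trace M.val * l + 1 ≠ 0 := by
  obtain ⟨N, hN, g, d, hd, hrange⟩ := h
  obtain ⟨r, hr, hMN⟩ := exists_smul_of_bar_eq hN.symm
  set f := algebraMap (ZMod p) (GaloisField p 2)
  have hdet := (slConj g (SpecialLinearGroup.map f N)).2
  have htr := trace_slConj g (SpecialLinearGroup.map f N)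
  have hval : (SpecialLinearGroup.map f N).val = N.val.map f := rfl
  have htrN : trace (N.val.map f) = f (trace N.val) := by
    rw [trace_fin_two, trace_fin_two, map_add]; rfl
  rw [slConj_val, hval, hd] at hdet htr
  rw [det_diagonal, Fin.prod_univ_two] at hdet
  rw [trace_diagonal, Fin.sum_univ_two, htrN] at htr
  rw [hMN, trace_smul, smul_eq_mul]
  intro h0
  have h0' := congrArg f h0
  have hr' := congrArg f hr
  simp only [map_add, map_sub, map_mul, map_pow, map_one, map_zero] at h0' hr'
  have : (f (r * l) - d 0) * (f (r * l) - d 1) = 0 := by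
    rw [map_mul]
    linear_combination h0' + (f l ^ 2) * hr' - f r * f l * htr + hdet
  rcases mul_eq_zero.1 this with h | h
  · exact hrange 0 ⟨_, sub_eq_zero.1 h⟩
  · exact hrange 1 ⟨_, sub_eq_zero.1 h⟩

lemma trace_sq_ne_four {K : Type*} [Field K] {t : K} (h : ∀ l : K, l ^ 2 - t * l + 1 ≠ 0) :
    t ^ 2 ≠ 4 := by
  intro h4
  rcases mul_eq_zero.1 (show (t - 2) * (t + 2) = 0 by linear_combination h4) with h' | h'
  · exact h 1 (by linear_combination -h')
  · exact h (-1) (by linear_combination h')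

/-! ### The map on equivalence classes and its injectivity. -/

lemma inPGL_bar_slConj (g : GL (Fin 2) (ZMod p)) (M : SL(2, ZMod p)) :
    inPGL p (bar p (slConj g M)) =
      ProjGenLinGroup.mk g * inPGL p (bar p M) * (ProjGenLinGroup.mk g)⁻¹ := by
  change ProjGenLinGroup.mk (SpecialLinearGroup.toGL (slConj g M)) = _ *
    ProjGenLinGroup.mk (SpecialLinearGroup.toGL M) * _
  rw [toGL_slConj, map_mul, map_mul, map_inv]

lemma pslCharacter_subset_of_conj {n : ℕ} {m m' : Fin n → PSL(2, ZMod p)}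
    (g : PGL(Fin 2, ZMod p)) (h : ∀ i, inPGL p (m' i) = g * inPGL p (m i) * g⁻¹) :
    pslCharacter (FreeGroup.lift m) ⊆ pslCharacter (FreeGroup.lift m') := by
  obtain ⟨g, rfl⟩ := ProjGenLinGroup.mk_surjective g
  rintro _ ⟨σ, hσ, rfl⟩
  refine ⟨(slConj g).comp σ, ?_, funext fun w => (trace_slConj g (σ w)).symm⟩
  refine FreeGroup.ext_hom _ _ fun i => ProjectiveSpecialLinearGroup.toPGL_injective ?_
  have hi : bar p (σ (FreeGroup.of i)) = m i := by
    rw [← MonoidHom.comp_apply, hσ, FreeGroup.lift_apply_of]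
  rw [FreeGroup.lift_apply_of]
  exact (inPGL_bar_slConj g _).trans (by rw [hi, h])

lemma tupleCharacter_eq_of_conj {n : ℕ} {m m' : Fin n → PSL(2, ZMod p)}
    (g : PGL(Fin 2, ZMod p)) (h : ∀ i, inPGL p (m' i) = g * inPGL p (m i) * g⁻¹) :
    tupleCharacter m = tupleCharacter m' := by
  refine Subtype.ext (Set.Subset.antisymm (pslCharacter_subset_of_conj g h)
    (pslCharacter_subset_of_conj g⁻¹ fun i => ?_))
  rw [h]
  group

lemma phi_eq_of_equivalent {γ δ : SL(2, ZMod p)} {Q R : Xtilde γ δ}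
    (h : Equivalent γ δ Q.1 R.1) : phi γ δ Q = phi γ δ R := by
  obtain ⟨c, -, d, -, h⟩ := h
  refine tupleCharacter_eq_of_conj d fun i => ?_
  fin_cases i
  all_goals
    simp only [Fin.zero_eta, Fin.mk_one, Fin.reduceFinMk, cons_val, map_mul, map_inv, h]
    group

/-- Quadruples with the same products are equivalent as soon as their triples of quotients are
conjugate. -/
lemma exists_conj_of_quotients_conj {G : Type*} [Group G] {q r : Fin 4 → G} {c d g : G}
    (hq : q 0 * (q 1)⁻¹ * q 2 * (q 3)⁻¹ = c) (hq' : (q 0)⁻¹ * q 1 * (q 2)⁻¹ * q 3 = d)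
    (hr : r 0 * (r 1)⁻¹ * r 2 * (r 3)⁻¹ = c) (hr' : (r 0)⁻¹ * r 1 * (r 2)⁻¹ * r 3 = d)
    (h₁ : (r 1)⁻¹ * r 0 = g * ((q 1)⁻¹ * q 0) * g⁻¹)
    (h₂ : (r 0)⁻¹ * r 2 = g * ((q 0)⁻¹ * q 2) * g⁻¹)
    (h₃ : (r 3)⁻¹ * r 2 = g * ((q 3)⁻¹ * q 2) * g⁻¹) :
    ∃ k ∈ Subgroup.centralizer {c}, ∃ e ∈ Subgroup.centralizer {d}, ∀ i, r i = k * q i * e := by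
  have e₀ : r 0 = (r 0 * g * (q 0)⁻¹) * q 0 * g⁻¹ := by group
  -- This choice makes the relation for index `0` automatic; the quotients propagate it to the other
  -- indices.
  set k := r 0 * g * (q 0)⁻¹ with hk
  have e₁ : r 1 = k * q 1 * g⁻¹ := by
    have : r 1 = r 0 * ((r 1)⁻¹ * r 0)⁻¹ := by group
    rw [this, h₁, hk]; group
  have e₂ : r 2 = k * q 2 * g⁻¹ := by
    have : r 2 = r 0 * ((r 0)⁻¹ * r 2) := by group
    rw [this, h₂, hk]; group
  have e₃ : r 3 = k * q 3 * g⁻¹ := by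
    have : r 3 = r 2 * ((r 3)⁻¹ * r 2)⁻¹ := by group
    rw [this, h₃, e₂]; group
  refine ⟨k, Subgroup.mem_centralizer_singleton_iff.2 ?_, g⁻¹,
    inv_mem (Subgroup.mem_centralizer_singleton_iff.2 ?_), fun i => ?_⟩
  · have : c = k * c * k⁻¹ := by
      conv_lhs => rw [← hr, e₀, e₁, e₂, e₃]
      rw [← hq]; group
    conv_rhs => rw [this]
    group
  · have : d = g * d * g⁻¹ := by
      conv_lhs => rw [← hr', e₀, e₁, e₂, e₃]
      rw [← hq']; group
    conv_rhs => rw [this]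
    group
  · fin_cases i
    exacts [e₀, e₁, e₂, e₃]

/-- The word with trace `tr δ`. -/
abbrev wordDelta : FreeGroup (Fin 3) := FreeGroup.of 0 * FreeGroup.of 2

/-- The word with trace `tr γ`. -/
abbrev wordGamma : FreeGroup (Fin 3) :=
  FreeGroup.of 0 * FreeGroup.of 1 * FreeGroup.of 2 * (FreeGroup.of 1)⁻¹

/-- The word is sent to a conjugate of `δ⁻¹`, and inversion preserves traces in `SL₂`. -/
lemma trace_wordDelta {A B C D δ : SL(2, ZMod p)} (h : A⁻¹ * B * C⁻¹ * D = δ) :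
    trace ((FreeGroup.lift ![B⁻¹ * A, A⁻¹ * C, D⁻¹ * C]) wordDelta).val = trace δ.val := by
  rw [← trace_inv δ, ← h, map_mul, FreeGroup.lift_apply_of, FreeGroup.lift_apply_of]
  have : (A⁻¹ * B * C⁻¹ * D)⁻¹ = (D⁻¹ * C) * (B⁻¹ * A) := by group
  rw [this]
  exact trace_mul_comm (B⁻¹ * A).val (D⁻¹ * C).val

lemma trace_wordGamma {A B C D γ : SL(2, ZMod p)} (h : A * B⁻¹ * C * D⁻¹ = γ) :
    trace ((FreeGroup.lift ![B⁻¹ * A, A⁻¹ * C, D⁻¹ * C]) wordGamma).val = trace γ.val := by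
  rw [← h, map_mul, map_mul, map_mul, map_inv, FreeGroup.lift_apply_of, FreeGroup.lift_apply_of,
    FreeGroup.lift_apply_of]
  change trace (B⁻¹ * A * (A⁻¹ * C) * (D⁻¹ * C) * (A⁻¹ * C)⁻¹).val = _
  have : B⁻¹ * A * (A⁻¹ * C) * (D⁻¹ * C) * (A⁻¹ * C)⁻¹ = (B⁻¹ * C * D⁻¹) * A := by group
  rw [this, mul_assoc A, mul_assoc A]
  exact trace_mul_comm (B⁻¹ * C * D⁻¹).val A.val

lemma equivalent_of_phi_eq {γ δ : SL(2, ZMod p)} (h : SplitNonsplit (bar p γ) (bar p δ))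
    {Q R : Xtilde γ δ} (hQR : phi γ δ Q = phi γ δ R) : Equivalent γ δ Q.1 R.1 := by
  obtain ⟨Q, A, B, C, D, hγ, hδ, rfl⟩ := Q
  obtain ⟨R, A', B', C', D', hγ', hδ', rfl⟩ := R
  set τ := FreeGroup.lift ![B'⁻¹ * A', A'⁻¹ * C', D'⁻¹ * C'] with hτ
  have hmem : slCharacter τ ∈ (phi γ δ ⟨_, A', B', C', D', hγ', hδ', rfl⟩).1 :=
    ⟨τ, lift_quotients A' B' C' D', rfl⟩
  -- Equality of the sets of characters yields a lift `σ` of the triple of `Q` with the character of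
  -- `τ`.
  rw [← hQR] at hmem
  obtain ⟨σ, hσ, hστ⟩ := hmem
  have hstr : ∀ w, trace (τ w).val = trace (σ w).val := fun w => congrFun hστ w
  obtain ⟨g, hg⟩ : ∃ g : GL (Fin 2) (ZMod p), ∀ w, σ w = slConj g (τ w) := by
    obtain ⟨⟨h1, -, -⟩, ⟨h1', -, -⟩, ⟨hs, hn⟩ | ⟨hn, hs⟩⟩ := h
    · refine exists_slConj_eq_of_trace_eq hstr (u := wordDelta) (v := wordGamma) ?_ ?_ ?_
      · rw [hτ, trace_wordDelta hδ']; exact hn.charpoly_ne_zero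
      · rw [hτ, trace_wordGamma hγ']; exact (hs.trace_of_ne_one h1).1
      · rw [hτ, trace_wordGamma hγ']; exact (hs.trace_of_ne_one h1).2
    · refine exists_slConj_eq_of_trace_eq hstr (u := wordGamma) (v := wordDelta) ?_ ?_ ?_
      · rw [hτ, trace_wordGamma hγ']; exact hn.charpoly_ne_zero
      · rw [hτ, trace_wordDelta hδ']; exact (hs.trace_of_ne_one h1').1
      · rw [hτ, trace_wordDelta hδ']; exact (hs.trace_of_ne_one h1').2
  have hgen : ∀ i, inPGL p (bar p (σ (FreeGroup.of i))) = ProjGenLinGroup.mk g *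
      inPGL p (bar p (τ (FreeGroup.of i))) * (ProjGenLinGroup.mk g)⁻¹ := fun i => by
    rw [hg, inPGL_bar_slConj]
  have hσi : ∀ i, bar p (σ (FreeGroup.of i)) =
      ![(bar p B)⁻¹ * bar p A, (bar p A)⁻¹ * bar p C, (bar p D)⁻¹ * bar p C] i := fun i => by
    rw [← MonoidHom.comp_apply, hσ, FreeGroup.lift_apply_of]
    rfl
  have hτi : ∀ i, bar p (τ (FreeGroup.of i)) = ![(bar p B')⁻¹ * bar p A',
      (bar p A')⁻¹ * bar p C', (bar p D')⁻¹ * bar p C'] i := fun i => by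
    rw [← MonoidHom.comp_apply, hτ, lift_quotients, FreeGroup.lift_apply_of]
  simp only [hσi, hτi] at hgen
  refine exists_conj_of_quotients_conj (g := ProjGenLinGroup.mk g)
    (q := fun i => inPGL p (![bar p A', bar p B', bar p C', bar p D'] i))
    (r := fun i => inPGL p (![bar p A, bar p B, bar p C, bar p D] i)) ?_ ?_ ?_ ?_ ?_ ?_ ?_
  · rw [← hγ']; simp
  · rw [← hδ']; simp
  · rw [← hγ]; simp
  · rw [← hδ]; simp
  · simpa using hgen 0
  · simpa using hgen 1
  · simpa using hgen 2

lemma SplitNonsplit.trace_sq_ne_four {γ δ : SL(2, ZMod p)}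
    (h : SplitNonsplit (bar p γ) (bar p δ)) : trace γ.val ^ 2 ≠ 4 ∧ trace δ.val ^ 2 ≠ 4 := by
  obtain ⟨⟨h1, -, -⟩, ⟨h1', -, -⟩, ⟨hs, hn⟩ | ⟨hn, hs⟩⟩ := h
  · exact ⟨(hs.trace_of_ne_one h1).2, BraidPSL.trace_sq_ne_four hn.charpoly_ne_zero⟩
  · exact ⟨BraidPSL.trace_sq_ne_four hn.charpoly_ne_zero, (hs.trace_of_ne_one h1').2⟩

/-! ### The image. -/

lemma exists_lift_of_phi_eq {γ δ : SL(2, ZMod p)} {Q : Xtilde γ δ} {m : Fin 3 → PSL(2, ZMod p)}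
    (h : phi γ δ Q = tupleCharacter m) :
    ∃ M₁ M₂ M₃ : SL(2, ZMod p), ![bar p M₁, bar p M₂, bar p M₃] = m ∧
      trace (M₁ * M₃).val = trace δ.val ∧ trace (M₁ * M₂ * M₃ * M₂⁻¹).val = trace γ.val := by
  obtain ⟨Q, A, B, C, D, hγ, hδ, rfl⟩ := Q
  set τ := FreeGroup.lift ![B⁻¹ * A, A⁻¹ * C, D⁻¹ * C] with hτ
  have hmem : slCharacter τ ∈ (phi γ δ ⟨_, A, B, C, D, hγ, hδ, rfl⟩).1 :=
    ⟨τ, lift_quotients A B C D, rfl⟩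
  rw [h] at hmem
  obtain ⟨σ, hσ, hστ⟩ := hmem
  refine ⟨σ (FreeGroup.of 0), σ (FreeGroup.of 1), σ (FreeGroup.of 2), funext fun i => ?_, ?_, ?_⟩
  · have : bar p (σ (FreeGroup.of i)) = m i := by
      rw [← MonoidHom.comp_apply, hσ, FreeGroup.lift_apply_of]
    rw [← this]
    fin_cases i <;> rfl
  · rw [← map_mul, ← trace_wordDelta hδ]
    exact (congrFun hστ wordDelta).symm
  · rw [← map_inv, ← map_mul, ← map_mul, ← map_mul, ← trace_wordGamma hγ]
    exact (congrFun hστ wordGamma).symm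

lemma exists_phi_eq {γ δ M₁ M₂ M₃ : SL(2, ZMod p)}
    (hγ : trace γ.val ^ 2 ≠ 4) (hδ : trace δ.val ^ 2 ≠ 4)
    (h₁ : trace (M₁ * M₃).val = trace δ.val)
    (h₂ : trace (M₁ * M₂ * M₃ * M₂⁻¹).val = trace γ.val) :
    ∃ Q : Xtilde γ δ, phi γ δ Q = tupleCharacter ![bar p M₁, bar p M₂, bar p M₃] := by
  have h₃ : trace ((M₃ * M₁)⁻¹).val = trace δ.val := by
    rw [trace_inv, ← h₁]
    exact trace_mul_comm M₃.val M₁.val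
  obtain ⟨g, hg⟩ := exists_slConj_eq (h₃ ▸ hδ) h₃
  have h₄ : trace (slConj g (M₁ * M₂ * M₃ * M₂⁻¹)).val = trace γ.val := by
    rw [trace_slConj, h₂]
  obtain ⟨A, hA⟩ := exists_mul_mul_inv_eq (h₄ ▸ hγ) h₄
  rw [map_inv, map_mul] at hg
  rw [map_mul, map_mul, map_mul, map_inv] at hA
  set N₁ := slConj g M₁ with hN₁
  set N₂ := slConj g M₂ with hN₂
  set N₃ := slConj g M₃ with hN₃
  -- The quotients are `N₁`, `N₂`, `N₃` for every `A`. The product for `δ` is `(N₃ * N₁)⁻¹`,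
  -- independent of `A`; the one for `γ` is the conjugate by `A` in `hA`.
  refine ⟨⟨_, A, A * N₁⁻¹, A * N₂, A * N₂ * N₃⁻¹, ?_, ?_, rfl⟩, ?_⟩
  · rw [← hA]; group
  · rw [← hg]; group
  · refine (tupleCharacter_eq_of_conj (ProjGenLinGroup.mk g) fun i => ?_).symm
    fin_cases i
    · simp [hN₁, ← inPGL_bar_slConj]
    · simp [hN₂, ← inPGL_bar_slConj]
    · simp [hN₃, inPGL_bar_slConj, mul_assoc]

end Prime

end BraidPSL

theorem mainTheorem10 (p : ℕ) [Fact p.Prime] (γ δ : SL(2, ZMod p))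
    (hsplit : BraidPSL.SplitNonsplit (BraidPSL.bar p γ) (BraidPSL.bar p δ))
    (horder : 60 < orderOf γ ∨ 60 < orderOf δ) :
    ∃ Φ : BraidPSL.X γ δ → BraidPSL.CharPSL p 3,
      (∀ Q : BraidPSL.Xtilde γ δ, Φ (Quotient.mk _ Q) = BraidPSL.phi γ δ Q) ∧
      Function.Injective Φ ∧
      ∀ m : Fin 3 → PSL(2, ZMod p),
        BraidPSL.tupleCharacter m ∈ Set.range Φ ↔
          ∃ M₁ M₂ M₃ : SL(2, ZMod p),
            ![BraidPSL.bar p M₁, BraidPSL.bar p M₂, BraidPSL.bar p M₃] = m ∧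
            Matrix.trace (M₁ * M₃).val = Matrix.trace δ.val ∧
            Matrix.trace (M₁ * M₂ * M₃ * M₂⁻¹).val = Matrix.trace γ.val := by
  refine ⟨Quotient.lift (BraidPSL.phi γ δ) fun _ _ h => BraidPSL.phi_eq_of_equivalent h,
    fun _ => rfl, ?_, fun m => ⟨?_, ?_⟩⟩
  · rintro ⟨Q⟩ ⟨R⟩ h
    exact Quotient.sound (BraidPSL.equivalent_of_phi_eq hsplit h)
  · rintro ⟨⟨Q⟩, h⟩
    exact BraidPSL.exists_lift_of_phi_eq h
  · rintro ⟨M₁, M₂, M₃, rfl, h₁, h₂⟩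
    obtain ⟨hγ, hδ⟩ := hsplit.trace_sq_ne_four
    obtain ⟨Q, hQ⟩ := BraidPSL.exists_phi_eq hγ hδ h₁ h₂
    exact ⟨Quotient.mk _ Q, hQ⟩
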